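/- Let $V=\{1,\dots,n\}$ and let $G=(V,E)$ be a directed graph (loops are allowed). A *constrained buck-holding game* $\hat\Gamma(G,\mu,\Xi)$ is given by a probability distribution $\mu$ on $V$ and, for each player $i\in V$, a nonempty set $\Xi_i$ of probability vectors $\pi_i=(\pi_{ij})_{j\in V}$ with $\pi_{ij}=0$ whenever $(i,j)\notin E$; put $\Xi=\prod_{i}\Xi_i$. A profile $\pi\in\Xi$ is a stochastic matrix; let $(X_t)_{t\ge 0}$ be the Markov chain with initial distribution $\mu$ and transition matrix $\pi$. The payoff of player $i$, which she wants to maximize, is $$c_i(\pi)=\mathbb E\Big[\lim_{T\to\infty}\frac1T\sum_{t=1}^{T}\mathbf 1_{\{X_t=i\}}\Big].$$ A profile $\pi\in\Xi$ is a *Nash equilibrium* if no player $i$ can strictly increase $c_i$ by replacing $\pi_i$ with another element of $\Xi_i$; it is *prior-free* (respectively *weakly prior-free*) if it is a Nash equilibrium of $\hat\Gamma(G,\nu,\Xi)$ for every (respectively every fully supported) distribution $\nu$ on $V$. For every constrained buck-holding game $\hat\Gamma(G,\mu,\Xi)$ and every $\pi\in\Xi$ the limit in the definition of $c_i(\pi)$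 exists almost surely. The game admits a Nash equilibrium that is weakly prior-free in each of the following cases: (i) $\Xi$ is finite and $\mu$ is fully supported; (ii) $\Xi$ is compact and every $\pi\in\Xi$ is irreducible. Case (ii) covers the *PageRank game*: let $\alpha\in(0,1)$, let $\nu$ be a fully supported distribution on $V$, for each $i$ let $S_i$ be a nonempty family of nonempty subsets of $V\setminus\{i\}$, and let $\Xi_i$ consist of the vectors $$\pi_{ij}=(1-\alpha)\frac{\mathbf 1_{\{j\in s_i\}}}{|s_i|}+\alpha\,\nu_j\quad(j\in V),\qquad s_i\in S_i,$$ where $G$ is the complete graph with loops. Then $\Xi$ is compact and every $\pi\in\Xi$ is irreducible, so that for every $\mu$ the game admits a Nash equilibrium that is weakly prior-free; moreover, all Nash equilibria of this game are prior-free. -/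

import Mathlib

open MeasureTheory ProbabilityTheory Filter Topology

namespace BuckHolding

/-- The probability measure on the players with the given vector of masses. -/
noncomputable def massMeasure {n : ℕ} (p : stdSimplex ℝ (Fin n)) : Measure (Fin n) :=
  ∑ j, ENNReal.ofReal (p.1 j) • Measure.dirac j

instance {n : ℕ} (p : stdSimplex ℝ (Fin n)) : IsProbabilityMeasure (massMeasure p) := by
  constructor
  have h : ∑ j, ENNReal.ofReal (p.1 j) = 1 := by
    rw [← ENNReal.ofReal_sum_of_nonneg (fun j _ => p.2.1 j), p.2.2, ENNReal.ofReal_one]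
  simpa [massMeasure] using h

/-- A strategy profile: the row `π i` is the distribution according to which player `i` passes
the buck, so `π` is at the same time a stochastic matrix. -/
abbrev Profile (n : ℕ) : Type := Fin n → stdSimplex ℝ (Fin n)

/-- The stochastic matrix with rows `π i`. -/
def Profile.toMatrix {n : ℕ} (π : Profile n) : Matrix (Fin n) (Fin n) ℝ :=
  Matrix.of fun i j => (π i).1 j

/-- The one-step transition kernel of the Markov chain with transition matrix `π`. -/
noncomputable def stepKernel {n : ℕ} (π : Profile n) : Kernel (Fin n) (Fin n) where
  toFun i := massMeasure (π i)
  measurable' := measurable_of_countable _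

instance {n : ℕ} (π : Profile n) : IsMarkovKernel (stepKernel π) :=
  ⟨fun i => inferInstanceAs (IsProbabilityMeasure (massMeasure (π i)))⟩

/-- The law of the position at time `t + 1` given the trajectory up to time `t`: the buck is
passed on by the player who holds it at time `t`. -/
noncomputable def historyKernel {n : ℕ} (π : Profile n) (t : ℕ) :
    Kernel ((s : Finset.Iic t) → (fun _ : ℕ => Fin n) s) ((fun _ : ℕ => Fin n) (t + 1)) :=
  (stepKernel π).comap (fun x => x ⟨t, Finset.mem_Iic.2 le_rfl⟩) (measurable_pi_apply _)

instance {n : ℕ} (π : Profile n) (t : ℕ) : IsMarkovKernel (historyKernel π t) :=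
  inferInstanceAs (IsMarkovKernel (Kernel.comap _ _ _))

/-- The law, on the space of trajectories `ℕ → Fin n`, of the time-homogeneous Markov chain with
initial distribution `μ` and transition matrix `π`. -/
noncomputable def chainLaw {n : ℕ} (μ : stdSimplex ℝ (Fin n)) (π : Profile n) :
    Measure (ℕ → Fin n) :=
  Kernel.trajMeasure (X := fun _ : ℕ => Fin n) (massMeasure μ) (historyKernel π)

/-- The fraction of the times `1, …, T` at which player `i` has the buck along the trajectory
`X`. -/
noncomputable def holdingFrequency {n : ℕ} (i : Fin n) (X : ℕ → Fin n) (T : ℕ) : ℝ :=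
  (1 / (T : ℝ)) * ∑ t ∈ Finset.Icc 1 T, if X t = i then 1 else 0

/-- The expected asymptotic frequency of times at which player `i` has the buck. -/
noncomputable def payoff {n : ℕ} (μ : stdSimplex ℝ (Fin n)) (π : Profile n) (i : Fin n) : ℝ :=
  ∫ X, limUnder atTop (holdingFrequency i X) ∂(chainLaw μ π)

/-- A distribution is fully supported if it charges every player. -/
def FullySupported {n : ℕ} (μ : stdSimplex ℝ (Fin n)) : Prop :=
  ∀ i, 0 < μ.1 i

end BuckHolding

/-- A constrained buck-holding game: a directed graph on the players `Fin n` (loops are permitted),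
the distribution `prior` of the initial holder of the buck, and for each player `i` a nonempty
set `strategies i` of probability vectors carried by the out-neighbours of `i`. -/
structure BuckHoldingGame (n : ℕ) where
  edge : Fin n → Fin n → Prop
  prior : stdSimplex ℝ (Fin n)
  strategies : Fin n → Set (stdSimplex ℝ (Fin n))
  strategies_nonempty : ∀ i, (strategies i).Nonempty
  strategies_edge : ∀ i, ∀ p ∈ strategies i, ∀ j, ¬ edge i j → p.1 j = 0

namespace BuckHoldingGame

open BuckHolding

variable {n : ℕ}

/-- The set of strategy profiles of the game. -/
def profiles (Γ : BuckHoldingGame n) : Set (Profile n) :=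
  Set.univ.pi Γ.strategies

/-- A Nash equilibrium: no player has a unilateral deviation that increases her payoff. -/
def IsNash (Γ : BuckHoldingGame n) (π : Profile n) : Prop :=
  π ∈ Γ.profiles ∧ ∀ i, ∀ q ∈ Γ.strategies i,
    ¬ payoff Γ.prior π i < payoff Γ.prior (Function.update π i q) i

/-- The same game with another initial distribution. -/
def withPrior (Γ : BuckHoldingGame n) (μ : stdSimplex ℝ (Fin n)) : BuckHoldingGame n :=
  { Γ with prior := μ }

/-- A weakly prior-free Nash equilibrium: an equilibrium for every fully supported initial
distribution. -/
def IsWeaklyPriorFreeNash (Γ : BuckHoldingGame n) (π : Profile n) : Prop :=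
  ∀ μ : stdSimplex ℝ (Fin n), FullySupported μ → (Γ.withPrior μ).IsNash π

/-- A prior-free Nash equilibrium: an equilibrium for every initial distribution. -/
def IsPriorFreeNash (Γ : BuckHoldingGame n) (π : Profile n) : Prop :=
  ∀ μ : stdSimplex ℝ (Fin n), (Γ.withPrior μ).IsNash π

end BuckHoldingGame

/-- The data of a PageRank game: a damping factor `α ∈ (0,1)`, a fully supported teleportation
distribution, and for each page `i` a nonempty family of admissible sets of out-links, each of
them a nonempty set of pages other than `i`. -/
structure PageRankData (n : ℕ) where
  α : ℝ
  α_pos : 0 < α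
  α_lt_one : α < 1
  teleport : stdSimplex ℝ (Fin n)
  teleport_full : BuckHolding.FullySupported teleport
  links : Fin n → Set (Finset (Fin n))
  links_nonempty : ∀ i, (links i).Nonempty
  nonempty_of_mem : ∀ i, ∀ s ∈ links i, s.Nonempty
  notMem_of_mem : ∀ i, ∀ s ∈ links i, i ∉ s

namespace PageRankData

variable {n : ℕ}

/-- The probability that a surfer on a page with the set `s` of out-links visits `j` next: with
probability `1 - α` she follows a uniformly random link, with probability `α` she teleports. -/
noncomputable def row (D : PageRankData n) (s : Finset (Fin n)) (j : Fin n) : ℝ :=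
  (1 - D.α) * ((if j ∈ s then 1 else 0) / (s.card : ℝ)) + D.α * D.teleport.1 j

theorem row_mem_stdSimplex (D : PageRankData n) {s : Finset (Fin n)} (hs : s.Nonempty) :
    D.row s ∈ stdSimplex ℝ (Fin n) := by
  have h1 : 0 ≤ 1 - D.α := by linarith [D.α_lt_one]
  have hc : (s.card : ℝ) ≠ 0 := by exact_mod_cast hs.card_pos.ne'
  refine ⟨fun j => ?_, ?_⟩
  · have h2 : (0 : ℝ) ≤ if j ∈ s then 1 else 0 := by split_ifs <;> norm_num
    exact add_nonneg (mul_nonneg h1 (div_nonneg h2 (Nat.cast_nonneg _)))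
      (mul_nonneg D.α_pos.le (D.teleport.2.1 j))
  · have h3 : ∑ j, D.teleport.1 j = 1 := D.teleport.2.2
    simp only [row, Finset.sum_add_distrib, ← Finset.mul_sum, ← Finset.sum_div, h3]
    simp [hc]

/-- The PageRank game as a constrained buck-holding game on the complete graph. Teleportation may
also leave the surfer where she is, so the complete graph is taken with loops. -/
noncomputable def game (D : PageRankData n) (μ : stdSimplex ℝ (Fin n)) : BuckHoldingGame n where
  edge _ _ := True
  prior := μ
  strategies i := {p | ∃ s ∈ D.links i, p.1 = D.row s}
  strategies_nonempty i := by
    obtain ⟨s, hs⟩ := D.links_nonempty i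
    exact ⟨⟨D.row s, D.row_mem_stdSimplex (D.nonempty_of_mem i s hs)⟩, s, hs, rfl⟩
  strategies_edge _ _ _ _ h := absurd trivial h

end PageRankData

/-! Write the indicator of player `i` as `h + (g - P g)` with `h` harmonic for the transition matrix
`P`. Along the chain `h (X t)` is a bounded martingale, hence converges, and the averages of `g - P
g` vanish by a law of large numbers for martingale differences. So the holding frequency converges
almost surely to the limit of `h (X t)`, and the payoff is `μ ⬝ᵥ h` (`payoff_eq_dotProduct`).

A determinant serves as potential. The function `h` is the limit, as `s → 1`, of the solution `x` of
`x - s P x = (1 - s) eᵢ`. By Cramer's rule `det (1 - s P) • x` does not depend on row `i`, the only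
row that player `i` controls, so lowering this positive determinant cannot lower her discounted
payoff. With finitely many profiles, one of them minimizes it for `s` arbitrarily close to `1`, and
is an equilibrium in the limit. For irreducible chains the determinant of `1 - P + 1 μᵀ` plays the
same role without discounting, and compactness provides a minimizer.

Cramer's rule also shows that the ratios `h k / h i` do not depend on row `i`
(`harmonicPart_cross_mul`): a deviation of `i` moves all `h k` the same way, so an equilibrium for
one fully supported prior is one for all priors. For irreducible chains `h` is constant and the
prior is irrelevant. -/

namespace Matrix

/-! ### Harmonic decomposition for a stochastic matrix -/

variable {ι : Type*} [Fintype ι] [DecidableEq ι] {P P' : Matrix ι ι ℝ}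

theorem norm_mulVec_le_of_mem_rowStochastic (hP : P ∈ rowStochastic ℝ ι) (f : ι → ℝ) :
    ‖P *ᵥ f‖ ≤ ‖f‖ := by
  refine (pi_norm_le_iff_of_nonneg (norm_nonneg f)).2 fun i => ?_
  calc ‖(P *ᵥ f) i‖ ≤ ∑ j, ‖P i j * f j‖ := norm_sum_le _ _
    _ ≤ ∑ j, P i j * ‖f‖ := Finset.sum_le_sum fun j _ => by
        rw [norm_mul, Real.norm_of_nonneg (nonneg_of_mem_rowStochastic hP)]
        exact mul_le_mul_of_nonneg_left (norm_le_pi_norm f j) (nonneg_of_mem_rowStochastic hP)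
    _ = ‖f‖ := by rw [← Finset.sum_mul, sum_row_of_mem_rowStochastic hP, one_mul]

/-- A harmonic function of the form `g - P g` vanishes. -/
theorem eq_zero_of_harmonic_of_eq_sub (hP : P ∈ rowStochastic ℝ ι) {h g : ι → ℝ}
    (hh : P *ᵥ h = h) (hg : h = g - P *ᵥ g) : h = 0 := by
  -- Since `g - (k + 1) h = P (g - k h)` and `P` is a contraction, `g - k h` stays bounded, which
  -- forces `h = 0`.
  have key : ∀ k : ℕ, ‖(k : ℝ) • h‖ ≤ ‖g‖ + ‖g‖ := by
    have main : ∀ k : ℕ, ‖g - (k : ℝ) • h‖ ≤ ‖g‖ := by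
      intro k
      induction k with
      | zero => simp
      | succ k ih =>
        have : g - ((k + 1 : ℕ) : ℝ) • h = P *ᵥ (g - (k : ℝ) • h) := by
          rw [mulVec_sub, mulVec_smul, hh]
          have : P *ᵥ g = g - h := by rw [hg]; abel
          rw [this]; push_cast; module
        rw [this]
        exact (norm_mulVec_le_of_mem_rowStochastic hP _).trans ih
    intro k
    have h1 : (k : ℝ) • h = g - (g - (k : ℝ) • h) := by abel
    rw [h1]
    exact (norm_sub_le _ _).trans (add_le_add le_rfl (main k))
  by_contra h0
  have hpos : 0 < ‖h‖ := norm_pos_iff.2 h0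
  obtain ⟨k, hk⟩ := exists_nat_gt ((‖g‖ + ‖g‖) / ‖h‖)
  have := key k
  rw [norm_smul, Real.norm_of_nonneg (Nat.cast_nonneg k)] at this
  rw [div_lt_iff₀ hpos] at hk
  linarith

/-- Every function is the sum of a harmonic function and a function of the form `g - P g`. -/
theorem exists_harmonic_add_sub (hP : P ∈ rowStochastic ℝ ι) (f : ι → ℝ) :
    ∃ h g : ι → ℝ, P *ᵥ h = h ∧ f = h + (g - P *ᵥ g) := by
  let T : (ι → ℝ) →ₗ[ℝ] (ι → ℝ) := LinearMap.id - P.mulVecLin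
  have hd : Disjoint (LinearMap.ker T) (LinearMap.range T) := by
    rw [Submodule.disjoint_def]
    rintro x hx ⟨g, hg⟩
    have hx' : x - P *ᵥ x = 0 := by simpa [T] using hx
    exact eq_zero_of_harmonic_of_eq_sub hP (sub_eq_zero.1 hx').symm (g := g)
      (by simpa [T] using hg.symm)
  -- By rank-nullity, disjointness of kernel and range already makes them complementary.
  have hc : IsCompl (LinearMap.ker T) (LinearMap.range T) := by
    rw [Submodule.isCompl_iff_disjoint]
    · exact hd
    · rw [add_comm, LinearMap.finrank_range_add_finrank_ker]
  have hf : f ∈ LinearMap.ker T ⊔ LinearMap.range T := by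
    rw [hc.sup_eq_top]; trivial
  obtain ⟨h, hh, y, ⟨g, rfl⟩, hy⟩ := Submodule.mem_sup.1 hf
  have hh' : h - P *ᵥ h = 0 := by simpa [T] using hh
  exact ⟨h, g, (sub_eq_zero.1 hh').symm, by simpa [T] using hy.symm⟩

/-- The harmonic part of `f`: the limit of the averages of `f, P f, P² f, …`. -/
noncomputable def harmonicPart (P : Matrix ι ι ℝ) (f : ι → ℝ) : ι → ℝ :=
  open Classical in
  if hP : P ∈ rowStochastic ℝ ι then (exists_harmonic_add_sub hP f).choose else 0

theorem harmonicPart_spec (hP : P ∈ rowStochastic ℝ ι) (f : ι → ℝ) :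
    ∃ g, P *ᵥ harmonicPart P f = harmonicPart P f ∧ f = harmonicPart P f + (g - P *ᵥ g) := by
  rw [harmonicPart, dif_pos hP]
  obtain ⟨g, hg⟩ := (exists_harmonic_add_sub hP f).choose_spec
  exact ⟨g, hg⟩

/-- The difference of two harmonic parts of `f` is harmonic and lies in the range of `1 - P`, so it
vanishes. -/
theorem harmonicPart_eq (hP : P ∈ rowStochastic ℝ ι) {f h g : ι → ℝ} (hh : P *ᵥ h = h)
    (hf : f = h + (g - P *ᵥ g)) : harmonicPart P f = h := by
  obtain ⟨g', h1, h2⟩ := harmonicPart_spec hP f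
  refine sub_eq_zero.1 (eq_zero_of_harmonic_of_eq_sub hP (g := g - g') ?_ ?_)
  · rw [mulVec_sub, h1, hh]
  · rw [mulVec_sub]
    have := h2.symm.trans hf
    calc harmonicPart P f - h = (harmonicPart P f + (g' - P *ᵥ g')) - h - (g' - P *ᵥ g') := by abel
      _ = _ := by rw [this]; abel

/-! ### The discounted equation and its limit as `s → 1` -/

theorem norm_le_of_sub_smul_mulVec_eq (hP : P ∈ rowStochastic ℝ ι) {s : ℝ} (hs0 : 0 ≤ s)
    (hs1 : s < 1) {x f : ι → ℝ} (hx : x - s • P *ᵥ x = (1 - s) • f) : ‖x‖ ≤ ‖f‖ := by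
  have h1 : x = s • P *ᵥ x + (1 - s) • f := by rw [← hx]; abel
  have h2 : ‖x‖ ≤ s * ‖x‖ + (1 - s) * ‖f‖ := by
    calc ‖x‖ = ‖s • P *ᵥ x + (1 - s) • f‖ := by rw [← h1]
      _ ≤ ‖s • P *ᵥ x‖ + ‖(1 - s) • f‖ := norm_add_le _ _
      _ = s * ‖P *ᵥ x‖ + (1 - s) * ‖f‖ := by
        rw [norm_smul, norm_smul, Real.norm_of_nonneg hs0, Real.norm_of_nonneg (by linarith)]
      _ ≤ _ := by
        gcongr
        exact norm_mulVec_le_of_mem_rowStochastic hP x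
  have h3 : (1 - s) * ‖x‖ ≤ (1 - s) * ‖f‖ := by linarith
  exact le_of_mul_le_mul_left h3 (by linarith)

theorem one_sub_smul_mulVec (s : ℝ) (x : ι → ℝ) : (1 - s • P) *ᵥ x = x - s • P *ᵥ x := by
  rw [sub_mulVec, one_mulVec, smul_mulVec]

/-- The solution of the discounted equation is close to the harmonic part. -/
theorem norm_resolvent_sub_harmonicPart_le (hP : P ∈ rowStochastic ℝ ι) (f : ι → ℝ) :
    ∃ C : ℝ, ∀ s : ℝ, 0 ≤ s → s < 1 → ∀ x : ι → ℝ, x - s • P *ᵥ x = (1 - s) • f →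
      ‖x - harmonicPart P f‖ ≤ (1 - s) * C := by
  obtain ⟨g, h1, h2⟩ := harmonicPart_spec hP f
  set h := harmonicPart P f
  refine ⟨2 * ‖g‖, fun s hs0 hs1 x hx => ?_⟩
  -- The approximate solution `h + (1 - s) g` leaves a residual of order `(1 - s)²`, so it misses
  -- `x` by at most `(1 - s) ‖g‖`; its own distance from `h` gives the second `‖g‖` in the constant.
  have h3 : (x - h - (1 - s) • g) - s • P *ᵥ (x - h - (1 - s) • g)
      = (1 - s) • (-((1 - s) • P *ᵥ g)) := by
    rw [mulVec_sub, mulVec_sub, mulVec_smul, h1]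
    calc _ = (x - s • P *ᵥ x) - (1 - s) • h - (1 - s) • (g - s • P *ᵥ g) := by module
      _ = _ := by rw [hx, h2]; module
  have h4 := norm_le_of_sub_smul_mulVec_eq hP hs0 hs1 h3
  rw [norm_neg, norm_smul, Real.norm_of_nonneg (by linarith)] at h4
  have h5 := norm_mulVec_le_of_mem_rowStochastic hP g
  calc ‖x - h‖ = ‖(x - h - (1 - s) • g) + (1 - s) • g‖ := by congr 1; abel
    _ ≤ ‖x - h - (1 - s) • g‖ + ‖(1 - s) • g‖ := norm_add_le _ _
    _ ≤ (1 - s) * ‖g‖ + (1 - s) * ‖g‖ := by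
      rw [norm_smul (1 - s) g, Real.norm_of_nonneg (by linarith : 0 ≤ 1 - s)]
      gcongr
      refine h4.trans ?_
      gcongr
    _ = _ := by ring

theorem det_one_sub_smul_ne_zero (hP : P ∈ rowStochastic ℝ ι) {s : ℝ} (hs0 : 0 ≤ s)
    (hs1 : s < 1) : (1 - s • P).det ≠ 0 := by
  intro h0
  obtain ⟨v, hv, hv0⟩ := exists_mulVec_eq_zero_iff.2 h0
  rw [one_sub_smul_mulVec] at hv0
  have := norm_le_of_sub_smul_mulVec_eq hP hs0 hs1 (x := v) (f := 0) (by simpa using hv0)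
  exact hv (norm_le_zero_iff.1 (by simpa using this))

theorem pos_of_continuous_of_ne_zero {φ : ℝ → ℝ} {s : ℝ} (hs : 0 ≤ s)
    (hφ : Continuous φ) (h0 : 0 < φ 0) (hne : ∀ t, 0 ≤ t → t ≤ s → φ t ≠ 0) : 0 < φ s := by
  by_contra hneg
  obtain ⟨t, ht, ht0⟩ := intermediate_value_Icc' hs hφ.continuousOn ⟨not_lt.1 hneg, h0.le⟩
  exact hne t ht.1 ht.2 ht0

/-- The determinant is `1` at `t = 0` and has no zero on `[0, s]`. Its sign is what allows payoffs
to be compared through determinants. -/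
theorem det_one_sub_smul_pos (hP : P ∈ rowStochastic ℝ ι) {s : ℝ} (hs0 : 0 ≤ s)
    (hs1 : s < 1) : 0 < (1 - s • P).det :=
  pos_of_continuous_of_ne_zero (φ := fun t => (1 - t • P).det) hs0
    (Continuous.matrix_det (by fun_prop)) (by simp)
    fun _ ht hts => det_one_sub_smul_ne_zero hP ht (hts.trans_lt hs1)

/-- The solution of `x - s P x = (1 - s) f`. -/
noncomputable def resolvent (P : Matrix ι ι ℝ) (s : ℝ) (f : ι → ℝ) : ι → ℝ :=
  (1 - s • P)⁻¹ *ᵥ ((1 - s) • f)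

theorem mulVec_resolvent (hP : P ∈ rowStochastic ℝ ι) {s : ℝ} (hs0 : 0 ≤ s) (hs1 : s < 1)
    (f : ι → ℝ) : (1 - s • P) *ᵥ resolvent P s f = (1 - s) • f := by
  rw [resolvent, mulVec_mulVec, mul_nonsing_inv, one_mulVec]
  exact (det_one_sub_smul_ne_zero hP hs0 hs1).isUnit

theorem tendsto_resolvent (hP : P ∈ rowStochastic ℝ ι) (f : ι → ℝ) :
    Tendsto (fun s => resolvent P s f) (𝓝[<] 1) (𝓝 (harmonicPart P f)) := by
  obtain ⟨C, hC⟩ := norm_resolvent_sub_harmonicPart_le hP f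
  rw [tendsto_iff_norm_sub_tendsto_zero]
  have h1 : Tendsto (fun s : ℝ => (1 - s) * C) (𝓝[<] 1) (𝓝 0) := by
    have : Tendsto (fun s : ℝ => (1 - s) * C) (𝓝 1) (𝓝 ((1 - 1) * C)) :=
      Continuous.tendsto (by fun_prop) _
    simpa using this.mono_left nhdsWithin_le_nhds
  refine tendsto_of_tendsto_of_tendsto_of_le_of_le' tendsto_const_nhds h1
    (Eventually.of_forall fun _ => norm_nonneg _) ?_
  filter_upwards [Ioo_mem_nhdsLT (zero_lt_one' ℝ)] with s hs
  exact hC s hs.1.le hs.2 _ (by rw [← one_sub_smul_mulVec, mulVec_resolvent hP hs.1.le hs.2])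

/-! ### Maximum principles and Cramer's rule -/

theorem mulVec_le_of_mem_rowStochastic (hP : P ∈ rowStochastic ℝ ι) {x : ι → ℝ} {c : ℝ}
    (hx : ∀ j, x j ≤ c) (i : ι) : (P *ᵥ x) i ≤ c := by
  calc ∑ j, P i j * x j ≤ ∑ j, P i j * c :=
        Finset.sum_le_sum fun j _ =>
          mul_le_mul_of_nonneg_left (hx j) (nonneg_of_mem_rowStochastic hP)
    _ = c := by rw [← Finset.sum_mul, sum_row_of_mem_rowStochastic hP, one_mul]

theorem le_mulVec_of_mem_rowStochastic (hP : P ∈ rowStochastic ℝ ι) {x : ι → ℝ} {c : ℝ}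
    (hx : ∀ j, c ≤ x j) (i : ι) : c ≤ (P *ᵥ x) i := by
  have := mulVec_le_of_mem_rowStochastic hP (x := -x) (c := -c) (fun j => by simpa using hx j) i
  rw [mulVec_neg] at this
  simpa using this

theorem nonneg_of_sub_smul_mulVec_nonneg (hP : P ∈ rowStochastic ℝ ι) {s : ℝ} (hs0 : 0 ≤ s)
    (hs1 : s < 1) {x : ι → ℝ} (hx : ∀ j, 0 ≤ (x - s • P *ᵥ x) j) (k : ι) : 0 ≤ x k := by
  obtain ⟨m, -, hm⟩ := Finset.exists_min_image Finset.univ x ⟨k, Finset.mem_univ k⟩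
  refine le_trans ?_ (hm k (Finset.mem_univ k))
  have h1 := le_mulVec_of_mem_rowStochastic hP (fun j => hm j (Finset.mem_univ j)) m
  have h2 : 0 ≤ x m - s * (P *ᵥ x) m := by simpa using hx m
  nlinarith [mul_le_mul_of_nonneg_left h1 hs0]

/-- At a maximum point `m ≠ i` the equation reads `x m = s (P x) m ≤ s x m`, so `x m ≤ 0`, and `x`
is nonnegative. -/
theorem le_apply_of_sub_smul_mulVec_eq_single (hP : P ∈ rowStochastic ℝ ι) {s : ℝ} (hs0 : 0 ≤ s)
    (hs1 : s < 1) {x : ι → ℝ} {i : ι} (hx : x - s • P *ᵥ x = (1 - s) • Pi.single i 1) (k : ι) :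
    0 ≤ x k ∧ x k ≤ x i := by
  have h0 : ∀ k, 0 ≤ x k := nonneg_of_sub_smul_mulVec_nonneg hP hs0 hs1 fun j => by
    rw [hx]
    have : (0 : ℝ) ≤ (Pi.single i 1 : ι → ℝ) j := by
      by_cases hj : j = i
      · subst hj; simp
      · simp [hj]
    simpa using mul_nonneg (sub_nonneg.2 hs1.le) this
  refine ⟨h0 k, ?_⟩
  obtain ⟨m, -, hm⟩ := Finset.exists_max_image Finset.univ x ⟨k, Finset.mem_univ k⟩
  refine (hm k (Finset.mem_univ k)).trans ?_
  by_cases hmi : m = i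
  · rw [hmi]
  · have h1 := mulVec_le_of_mem_rowStochastic hP (fun j => hm j (Finset.mem_univ j)) m
    have h2 : x m - s * (P *ᵥ x) m = 0 := by simpa [hmi] using congrFun hx m
    have h3 : x m ≤ 0 := by nlinarith [mul_le_mul_of_nonneg_left h1 hs0]
    exact h3.trans (h0 i)

theorem harmonicPart_single_mem (hP : P ∈ rowStochastic ℝ ι) (i k : ι) :
    0 ≤ harmonicPart P (Pi.single i 1) k ∧
      harmonicPart P (Pi.single i 1) k ≤ harmonicPart P (Pi.single i 1) i := by
  have ht := tendsto_pi_nhds.1 (tendsto_resolvent hP (Pi.single i 1))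
  have hev : ∀ᶠ s in 𝓝[<] (1 : ℝ), 0 ≤ resolvent P s (Pi.single i 1) k ∧
      resolvent P s (Pi.single i 1) k ≤ resolvent P s (Pi.single i 1) i := by
    filter_upwards [Ioo_mem_nhdsLT (zero_lt_one' ℝ)] with s hs
    exact le_apply_of_sub_smul_mulVec_eq_single hP hs.1.le hs.2
      (by rw [← one_sub_smul_mulVec, mulVec_resolvent hP hs.1.le hs.2]) k
  exact ⟨ge_of_tendsto (ht k) (hev.mono fun _ h => h.1),
    le_of_tendsto_of_tendsto (ht k) (ht i) (hev.mono fun _ h => h.2)⟩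

/-- Cramer's rule: the numerators of the solution of `M x = c eᵢ` do not depend on row `i`. -/
theorem det_smul_eq_det_smul_of_mulVec_eq_single {M M' : Matrix ι ι ℝ} {i : ι}
    (hM : ∀ k, k ≠ i → M k = M' k) {x x' : ι → ℝ} {c : ℝ} (hx : M *ᵥ x = c • Pi.single i 1)
    (hx' : M' *ᵥ x' = c • Pi.single i 1) : M.det • x = M'.det • x' := by
  -- Multiplying by the adjugate leaves its column `i`, whose entries are determinants of `N` with
  -- row `i` overwritten.
  have h1 : ∀ (N : Matrix ι ι ℝ) (y : ι → ℝ), N *ᵥ y = c • Pi.single i 1 →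
      N.det • y = c • fun k => (N.updateRow i (Pi.single k 1)).det := by
    intro N y hy
    have : N.adjugate *ᵥ (N *ᵥ y) = N.det • y := by
      rw [mulVec_mulVec, adjugate_mul, smul_mulVec, one_mulVec]
    rw [← this, hy, mulVec_smul, mulVec_single_one]
    congr 1
    ext k
    simp [adjugate_apply]
  have h2 : M' = M.updateRow i (M' i) := by
    ext k l
    by_cases hk : k = i
    · subst hk; simp
    · rw [updateRow_ne hk, hM k hk]
  rw [h1 M x hx, h1 M' x' hx', h2]
  simp only [updateRow_idem]

theorem one_sub_smul_apply_eq {κ : Type*} [DecidableEq κ] {Q Q' : Matrix κ κ ℝ} {i : κ}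
    (hQ : ∀ k, k ≠ i → Q k = Q' k) (s : ℝ) (k : κ) (hk : k ≠ i) :
    (1 - s • Q) k = (1 - s • Q') k := by
  ext l
  simp [congrFun (hQ k hk) l]

/-- For `s < 1` the two discounted solutions are proportional by Cramer's rule. The product form
survives the limit even when the entry at `i` vanishes. -/
theorem harmonicPart_cross_mul (hP : P ∈ rowStochastic ℝ ι) (hP' : P' ∈ rowStochastic ℝ ι)
    {i : ι} (hPP : ∀ k, k ≠ i → P k = P' k) (k : ι) :
    harmonicPart P (Pi.single i 1) k * harmonicPart P' (Pi.single i 1) i =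
      harmonicPart P' (Pi.single i 1) k * harmonicPart P (Pi.single i 1) i := by
  have ht := tendsto_pi_nhds.1 (tendsto_resolvent hP (Pi.single i 1))
  have ht' := tendsto_pi_nhds.1 (tendsto_resolvent hP' (Pi.single i 1))
  refine tendsto_nhds_unique_of_eventuallyEq ((ht k).mul (ht' i)) ((ht' k).mul (ht i)) ?_
  filter_upwards [Ioo_mem_nhdsLT (zero_lt_one' ℝ)] with s hs
  have h1 := det_smul_eq_det_smul_of_mulVec_eq_single (one_sub_smul_apply_eq hPP s)
    (mulVec_resolvent hP hs.1.le hs.2 _) (mulVec_resolvent hP' hs.1.le hs.2 _)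
  have hk := congrFun h1 k
  have hi := congrFun h1 i
  have hd := det_one_sub_smul_ne_zero hP hs.1.le hs.2
  have hd' := det_one_sub_smul_ne_zero hP' hs.1.le hs.2
  simp only [Pi.smul_apply, smul_eq_mul] at hk hi
  apply mul_left_cancel₀ (mul_ne_zero hd hd')
  linear_combination ((1 - s • P').det * resolvent P' s (Pi.single i 1) i) * hk
    - ((1 - s • P').det * resolvent P' s (Pi.single i 1) k) * hi

/-! ### Irreducible matrices -/

/-- At a maximum point `m`, the average of the nonnegative function `h m - h p` under row `m` of `P
^ r` is `0`; irreducibility gives an `r` for which this row charges a prescribed `l`. -/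
theorem apply_eq_of_harmonic_of_isIrreducible (hP : P ∈ rowStochastic ℝ ι)
    (hirr : P.IsIrreducible) {h : ι → ℝ} (hh : P *ᵥ h = h) (j k : ι) : h j = h k := by
  obtain ⟨m, -, hm⟩ := Finset.exists_max_image Finset.univ h ⟨k, Finset.mem_univ k⟩
  suffices H : ∀ l, h l = h m by rw [H j, H k]
  intro l
  obtain ⟨r, -, hr⟩ := (isIrreducible_iff_exists_pow_pos hirr.nonneg).1 hirr m l
  have hpow : ∀ r : ℕ, (P ^ r) *ᵥ h = h := by
    intro r
    induction r with
    | zero => simp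
    | succ r ih => rw [pow_succ, ← mulVec_mulVec, hh, ih]
  have hPr := pow_mem hP r
  have h1 : ∑ p, (P ^ r) m p * (h m - h p) = 0 := by
    simp only [mul_sub, Finset.sum_sub_distrib, ← Finset.sum_mul,
      sum_row_of_mem_rowStochastic hPr, one_mul]
    exact sub_eq_zero.2 (congrFun (hpow r) m).symm
  rw [Finset.sum_eq_zero_iff_of_nonneg fun p hp => mul_nonneg (nonneg_of_mem_rowStochastic hPr)
    (sub_nonneg.2 (hm p hp))] at h1
  rcases mul_eq_zero.1 (h1 l (Finset.mem_univ l)) with h2 | h2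
  · exact absurd h2 hr.ne'
  · linarith

theorem mulVec_const_of_mem_rowStochastic (hP : P ∈ rowStochastic ℝ ι) (c : ℝ) :
    P *ᵥ (fun _ => c) = fun _ => c := by
  ext i
  exact le_antisymm (mulVec_le_of_mem_rowStochastic hP (fun _ => le_rfl) i)
    (le_mulVec_of_mem_rowStochastic hP (fun _ => le_rfl) i)

theorem one_sub_smul_add_vecMulVec_mulVec (v : ι → ℝ) (s : ℝ) (x : ι → ℝ) :
    (1 - s • P + vecMulVec 1 v) *ᵥ x = x - s • P *ᵥ x + fun _ => v ⬝ᵥ x := by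
  rw [add_mulVec, one_sub_smul_mulVec, vecMulVec_mulVec]
  ext; simp

/-- Deform `P` to `t P`: the determinant equals `2` at `t = 0` and never vanishes up to `t = 1`. -/
theorem det_one_sub_add_vecMulVec_pos (hP : P ∈ rowStochastic ℝ ι) (hirr : P.IsIrreducible)
    {v : ι → ℝ} (hv : ∑ i, v i = 1) : 0 < (1 - P + vecMulVec 1 v).det := by
  have h1 : 0 < (fun t : ℝ => (1 - t • P + vecMulVec 1 v).det) 1 := by
    refine pos_of_continuous_of_ne_zero (φ := fun t : ℝ => (1 - t • P + vecMulVec 1 v).det)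
      zero_le_one (Continuous.matrix_det (by fun_prop)) ?_ ?_
    · have : (1 + vecMulVec (1 : ι → ℝ) v).det = 1 + v ⬝ᵥ 1 := by
        rw [vecMulVec_eq Unit, det_one_add_replicateCol_mul_replicateRow]
      simp only [zero_smul, sub_zero, this]
      simp [dotProduct, hv]
    · intro t ht0 ht1 h0
      obtain ⟨x, hx, hx0⟩ := exists_mulVec_eq_zero_iff.2 h0
      rw [one_sub_smul_add_vecMulVec_mulVec] at hx0
      have hvc : ∀ c : ℝ, v ⬝ᵥ (fun _ => c) = c := fun c => by
        simp [dotProduct, ← Finset.sum_mul, hv]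
      rcases ht1.lt_or_eq with ht | rfl
      -- For `t < 1` a kernel vector must be the constant `-c / (1 - t)`; pairing with `v` gives `c
      -- (2 - t) = 0`.
      · have hne : 1 - t ≠ 0 := by linarith
        set c := v ⬝ᵥ x with hc
        have hx1 : x - t • P *ᵥ x = (1 - t) • fun _ => -(c / (1 - t)) := by
          rw [eq_neg_of_add_eq_zero_left hx0]
          ext; simp; field_simp
        have hx2 : x + (fun _ => c / (1 - t)) = 0 := by
          have h3 : (x + fun _ => c / (1 - t)) - t • P *ᵥ (x + fun _ => c / (1 - t))
              = (1 - t) • (0 : ι → ℝ) := by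
            rw [mulVec_add, mulVec_const_of_mem_rowStochastic hP]
            calc _ = (x - t • P *ᵥ x) + (1 - t) • (fun _ => c / (1 - t)) := by module
              _ = _ := by rw [hx1]; ext; simp
          exact norm_le_zero_iff.1
            (by simpa using norm_le_of_sub_smul_mulVec_eq hP ht0 ht h3)
        have hx3 : x = fun _ => -(c / (1 - t)) := eq_neg_of_add_eq_zero_left hx2
        have hx4 : c = -(c / (1 - t)) := by
          rw [← hvc (-(c / (1 - t))), ← hx3]
        have hc0 : c = 0 := by
          field_simp at hx4
          nlinarith
        exact hx (by rw [hx3, hc0]; ext; simp)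
      -- At `t = 1` the constant `-c` equals `x - P x`, hence is `0`; then `x` is harmonic, so
      -- constant with value `c`.
      · set c := v ⬝ᵥ x with hc
        rw [one_smul] at hx0
        have h3 : (fun _ : ι => -c) = 0 := by
          refine eq_zero_of_harmonic_of_eq_sub hP (mulVec_const_of_mem_rowStochastic hP _)
            (g := x) ?_
          rw [eq_neg_of_add_eq_zero_left hx0]; rfl
        have hxP : P *ᵥ x = x := by
          have h4 : x - P *ᵥ x = 0 := by
            rw [eq_neg_of_add_eq_zero_left hx0]; exact h3
          exact (sub_eq_zero.1 h4).symm
        obtain ⟨k, hk⟩ := Function.ne_iff.1 hx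
        have hxc : x = fun _ => x k :=
          funext fun j => apply_eq_of_harmonic_of_isIrreducible hP hirr hxP j k
        have hck : c = x k := by rw [hc, hxc, hvc]
        exact hk (by rw [← hck]; simpa using congrFun h3 k)
  simpa using h1

/-- For an irreducible chain the harmonic part is a constant that solves a linear system. -/
theorem harmonicPart_eq_dotProduct (hP : P ∈ rowStochastic ℝ ι) {v x f : ι → ℝ}
    (hx : (1 - P + vecMulVec 1 v) *ᵥ x = f) : harmonicPart P f = fun _ => v ⬝ᵥ x := by
  refine harmonicPart_eq hP (mulVec_const_of_mem_rowStochastic hP _) (g := x) ?_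
  have := one_sub_smul_add_vecMulVec_mulVec (P := P) v 1 x
  rw [one_smul, one_smul] at this
  rw [← hx, this, add_comm]

end Matrix

/-! ### The Markov chain and the Markov property -/

namespace BuckHolding

open Matrix Preorder

variable {n : ℕ}

/-- The filtration generated by the trajectory. -/
abbrev trajectoryFiltration (n : ℕ) :
    Filtration ℕ (MeasurableSpace.pi : MeasurableSpace (ℕ → Fin n)) :=
  Filtration.piLE (X := fun _ : ℕ => Fin n)

theorem ae_exists_tendsto_of_martingale {Ω : Type*} {m : MeasurableSpace Ω} {P : Measure Ω}
    [IsProbabilityMeasure P] {ℱ : Filtration ℕ m} {f : ℕ → Ω → ℝ} (hf : Martingale f ℱ P) {C : ℝ}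
    (hC : ∀ t, ∫ ω, ‖f t ω‖ ∂P ≤ C) : ∀ᵐ ω ∂P, ∃ l, Tendsto (fun t => f t ω) atTop (𝓝 l) := by
  refine hf.submartingale.exists_ae_tendsto_of_bdd (R := C.toNNReal) fun t => ?_
  rw [eLpNorm_one_eq_lintegral_enorm, ← ofReal_integral_norm_eq_lintegral_enorm (hf.integrable t)]
  exact ENNReal.ofReal_le_ofReal (hC t)

theorem Profile.toMatrix_mem_rowStochastic (π : Profile n) :
    π.toMatrix ∈ rowStochastic ℝ (Fin n) :=
  mem_rowStochastic_iff_sum.2 ⟨fun i j => (π i).2.1 j, fun i => (π i).2.2⟩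

theorem integral_massMeasure (p : stdSimplex ℝ (Fin n)) (f : Fin n → ℝ) :
    ∫ j, f j ∂(massMeasure p) = ∑ j, p.1 j * f j := by
  rw [massMeasure, integral_finsetSum_measure]
  · refine Finset.sum_congr rfl fun j _ => ?_
    rw [integral_smul_measure, integral_dirac, ENNReal.toReal_ofReal (p.2.1 j), smul_eq_mul]
  · exact fun j _ => (integrable_dirac (by simp)).smul_measure (by simp)

instance (μ : stdSimplex ℝ (Fin n)) (π : Profile n) : IsProbabilityMeasure (chainLaw μ π) :=
  inferInstanceAs (IsProbabilityMeasure (Kernel.trajMeasure _ _))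

theorem nonempty_of_stdSimplex (p : stdSimplex ℝ (Fin n)) : Nonempty (Fin n) := by
  by_contra h
  rw [not_nonempty_iff] at h
  simpa using p.2.2

/-- Functions of the position at time `t` are bounded, hence integrable. -/
theorem integrable_comp_eval (μ : stdSimplex ℝ (Fin n)) (π : Profile n) (f : Fin n → ℝ) (t : ℕ) :
    Integrable (fun X : ℕ → Fin n => f (X t)) (chainLaw μ π) :=
  Integrable.of_bound ((measurable_of_countable f).comp (measurable_pi_apply t)).aestronglyMeasurable
    ‖f‖ (Eventually.of_forall fun X => norm_le_pi_norm f (X t))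

theorem map_eval_zero_chainLaw (μ : stdSimplex ℝ (Fin n)) (π : Profile n) :
    (chainLaw μ π).map (fun X => X 0) = massMeasure μ := by
  have h1 : (fun X : ℕ → Fin n => X 0) =
      (MeasurableEquiv.piUnique (fun _ : Finset.Iic 0 => Fin n)) ∘ frestrictLe 0 := rfl
  rw [h1, ← Measure.map_map (by fun_prop) (by fun_prop), chainLaw, Kernel.trajMeasure,
    Measure.map_comp _ _ (by fun_prop), Kernel.traj_map_frestrictLe, Kernel.partialTraj_self,
    Measure.id_comp, Measure.map_map (by fun_prop) (by fun_prop)]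
  have h2 : (MeasurableEquiv.piUnique (fun _ : Finset.Iic 0 => Fin n)) ∘
      (MeasurableEquiv.piUnique (fun _ : Finset.Iic 0 => Fin n)).symm = id := by
    ext x; simp
  exact (congrArg (fun φ => Measure.map φ (massMeasure μ)) h2).trans Measure.map_id

theorem integral_comp_eval_zero (μ : stdSimplex ℝ (Fin n)) (π : Profile n) (f : Fin n → ℝ) :
    ∫ X, f (X 0) ∂(chainLaw μ π) = ∑ j, μ.1 j * f j := by
  rw [← integral_massMeasure, ← map_eval_zero_chainLaw μ π, integral_map (measurable_pi_apply 0).aemeasurable]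
  exact (measurable_of_countable f).aestronglyMeasurable

/-- The Markov property. -/
theorem condExp_comp_eval_succ (μ : stdSimplex ℝ (Fin n)) (π : Profile n) (f : Fin n → ℝ)
    (t : ℕ) :
    (chainLaw μ π)[fun X => f (X (t + 1)) | trajectoryFiltration n t]
      =ᵐ[chainLaw μ π] fun X => (π.toMatrix *ᵥ f) (X t) := by
  have := nonempty_of_stdSimplex μ
  have h1 := condExp_ae_eq_integral_condDistrib (μ := chainLaw μ π)
    (X := frestrictLe (π := fun _ : ℕ => Fin n) t) (Y := fun X => X (t + 1))
    (measurable_frestrictLe (X := fun _ : ℕ => Fin n) t) (measurable_pi_apply (t + 1)).aemeasurable (f := f) (measurable_of_countable f).stronglyMeasurable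
    (integrable_comp_eval μ π f (t + 1))
  rw [← Filtration.piLE_eq_comap_frestrictLe (X := fun _ : ℕ => Fin n)] at h1
  have h2 := ae_of_ae_map (by fun_prop)
    (Kernel.condDistrib_trajMeasure (X := fun _ : ℕ => Fin n) (μ₀ := massMeasure μ)
      (κ := historyKernel π) (a := t))
  refine h1.trans ?_
  filter_upwards [h2] with X hX
  -- The conditional law of the next position sees only the last coordinate of the history.
  have h3 : historyKernel π t (frestrictLe t X) = massMeasure (π (X t)) := rfl
  have h4 : condDistrib (fun X : ℕ → Fin n => X (t + 1))
      (frestrictLe (π := fun _ : ℕ => Fin n) t) (chainLaw μ π) (frestrictLe t X) =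
      massMeasure (π (X t)) := hX.trans h3
  rw [h4, integral_massMeasure]
  rfl

theorem stronglyMeasurable_comp_eval (f : Fin n → ℝ) {s t : ℕ} (hst : s ≤ t) :
    StronglyMeasurable[trajectoryFiltration n t]
      (fun X : ℕ → Fin n => f (X s)) := by
  refine Measurable.stronglyMeasurable ?_
  refine (measurable_of_countable f).comp ?_
  rw [Filtration.piLE_eq_comap_frestrictLe]
  exact (measurable_pi_apply (⟨s, Finset.mem_Iic.2 hst⟩ : Finset.Iic t)).comp
    (comap_measurable (frestrictLe (π := fun _ : ℕ => Fin n) t))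

/-! ### Almost sure convergence of the holding frequency -/

/-- The increment of the martingale attached to `g`. -/
def increment (π : Profile n) (g : Fin n → ℝ) (s : ℕ) (X : ℕ → Fin n) : ℝ :=
  g (X (s + 1)) - (π.toMatrix *ᵥ g) (X s)

theorem norm_increment_le (π : Profile n) (g : Fin n → ℝ) (s : ℕ) (X : ℕ → Fin n) :
    ‖increment π g s X‖ ≤ 2 * ‖g‖ := by
  calc ‖increment π g s X‖ ≤ ‖g (X (s + 1))‖ + ‖(π.toMatrix *ᵥ g) (X s)‖ := norm_sub_le _ _
    _ ≤ ‖g‖ + ‖g‖ := add_le_add (norm_le_pi_norm g _) ((norm_le_pi_norm _ _).trans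
        (norm_mulVec_le_of_mem_rowStochastic π.toMatrix_mem_rowStochastic g))
    _ = _ := by ring

theorem stronglyMeasurable_increment (π : Profile n) (g : Fin n → ℝ) {s t : ℕ} (hst : s < t) :
    StronglyMeasurable[trajectoryFiltration n t] (increment π g s) :=
  (stronglyMeasurable_comp_eval g hst).sub (stronglyMeasurable_comp_eval _ hst.le)

theorem integrable_increment (μ : stdSimplex ℝ (Fin n)) (π : Profile n) (g : Fin n → ℝ) (s : ℕ) :
    Integrable (increment π g s) (chainLaw μ π) :=
  (integrable_comp_eval μ π g (s + 1)).sub (integrable_comp_eval μ π _ s)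

theorem condExp_increment (μ : stdSimplex ℝ (Fin n)) (π : Profile n) (g : Fin n → ℝ) (s : ℕ) :
    (chainLaw μ π)[increment π g s | trajectoryFiltration n s]
      =ᵐ[chainLaw μ π] 0 := by
  have h1 := condExp_sub (μ := chainLaw μ π) (integrable_comp_eval μ π g (s + 1))
    (integrable_comp_eval μ π (π.toMatrix *ᵥ g) s)
    (trajectoryFiltration n s)
  refine h1.trans ?_
  rw [condExp_of_stronglyMeasurable (Filtration.le _ _)
    (stronglyMeasurable_comp_eval (π.toMatrix *ᵥ g) le_rfl) (integrable_comp_eval μ π _ s)]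
  filter_upwards [condExp_comp_eval_succ μ π g s] with X hX
  simp [hX]

theorem ae_exists_tendsto_of_harmonic (μ : stdSimplex ℝ (Fin n)) (π : Profile n)
    {h : Fin n → ℝ} (hh : π.toMatrix *ᵥ h = h) :
    ∀ᵐ X ∂(chainLaw μ π), ∃ l, Tendsto (fun t => h (X t)) atTop (𝓝 l) := by
  have hm : Martingale (fun t (X : ℕ → Fin n) => h (X t)) (trajectoryFiltration n) (chainLaw μ π) := by
    refine martingale_nat (fun t => stronglyMeasurable_comp_eval h le_rfl)
      (fun t => integrable_comp_eval μ π h t) fun t => ?_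
    have := condExp_comp_eval_succ μ π h t
    rw [hh] at this
    exact this.symm
  refine ae_exists_tendsto_of_martingale hm (C := ‖h‖) fun t => ?_
  calc ∫ X, ‖h (X t)‖ ∂(chainLaw μ π) ≤ ∫ _, ‖h‖ ∂(chainLaw μ π) :=
        integral_mono (integrable_comp_eval μ π h t).norm (integrable_const _)
          fun X => norm_le_pi_norm h (X t)
    _ = ‖h‖ := by simp

/-- The martingale with the increments of `g` scaled by `1 / (s + 1)`. -/
noncomputable def scaledSum (π : Profile n) (g : Fin n → ℝ) (t : ℕ) (X : ℕ → Fin n) : ℝ :=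
  ∑ s ∈ Finset.range t, ((s : ℝ) + 1)⁻¹ * increment π g s X

theorem scaledSum_succ (π : Profile n) (g : Fin n → ℝ) (t : ℕ) (X : ℕ → Fin n) :
    scaledSum π g (t + 1) X = scaledSum π g t X + ((t : ℝ) + 1)⁻¹ * increment π g t X :=
  Finset.sum_range_succ _ _

theorem norm_scaledSum_le (π : Profile n) (g : Fin n → ℝ) (t : ℕ) (X : ℕ → Fin n) :
    ‖scaledSum π g t X‖ ≤ t * (2 * ‖g‖) := by
  refine (norm_sum_le _ _).trans ?_
  calc _ ≤ ∑ s ∈ Finset.range t, 2 * ‖g‖ := Finset.sum_le_sum fun s _ => by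
        rw [norm_mul, Real.norm_of_nonneg (by positivity)]
        have h1 : ((s : ℝ) + 1)⁻¹ ≤ 1 := inv_le_one_of_one_le₀ (by
          have : (0 : ℝ) ≤ s := Nat.cast_nonneg s
          linarith)
        calc _ ≤ 1 * ‖increment π g s X‖ := by gcongr
          _ ≤ _ := by rw [one_mul]; exact norm_increment_le π g s X
    _ = _ := by simp

theorem stronglyMeasurable_scaledSum (π : Profile n) (g : Fin n → ℝ) (t : ℕ) :
    StronglyMeasurable[trajectoryFiltration n t] (scaledSum π g t) := by
  have : scaledSum π g t = fun X => ∑ s ∈ Finset.range t, ((s : ℝ) + 1)⁻¹ * increment π g s X := rfl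
  rw [this]
  refine Finset.stronglyMeasurable_fun_sum _ fun s hs => ?_
  exact (stronglyMeasurable_increment π g (Finset.mem_range.1 hs)).const_mul _

theorem integrable_scaledSum (μ : stdSimplex ℝ (Fin n)) (π : Profile n) (g : Fin n → ℝ) (t : ℕ) :
    Integrable (scaledSum π g t) (chainLaw μ π) :=
  integrable_finsetSum _ fun s _ => (integrable_increment μ π g s).const_mul _

theorem martingale_scaledSum (μ : stdSimplex ℝ (Fin n)) (π : Profile n) (g : Fin n → ℝ) :
    Martingale (scaledSum π g) (trajectoryFiltration n) (chainLaw μ π) := by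
  refine martingale_nat (stronglyMeasurable_scaledSum π g) (integrable_scaledSum μ π g) fun t => ?_
  have h1 : scaledSum π g (t + 1) = scaledSum π g t + ((t : ℝ) + 1)⁻¹ • increment π g t := by
    ext X; simp [scaledSum_succ]
  rw [h1]
  have h2 := condExp_add (μ := chainLaw μ π) (integrable_scaledSum μ π g t)
    ((integrable_increment μ π g t).smul ((t : ℝ) + 1)⁻¹)
    (trajectoryFiltration n t)
  rw [condExp_of_stronglyMeasurable (Filtration.le _ _) (stronglyMeasurable_scaledSum π g t)
    (integrable_scaledSum μ π g t)] at h2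
  filter_upwards [h2, condExp_smul (μ := chainLaw μ π) (((t : ℝ) + 1)⁻¹) (increment π g t)
    (trajectoryFiltration n t), condExp_increment μ π g t] with X hX hX' hX''
  rw [hX]
  simp [hX', hX'']

/-- Conditioning on time `t` pulls out the sum and kills the increment. This orthogonality makes the
second moments add up. -/
theorem integral_scaledSum_mul_increment (μ : stdSimplex ℝ (Fin n)) (π : Profile n)
    (g : Fin n → ℝ) (t : ℕ) :
    ∫ X, scaledSum π g t X * increment π g t X ∂(chainLaw μ π) = 0 := by
  have h1 := condExp_stronglyMeasurable_mul_of_bound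
    ((trajectoryFiltration n).le t) (μ := chainLaw μ π)
    (stronglyMeasurable_scaledSum π g t) (integrable_increment μ π g t) _
    (Eventually.of_forall fun X => norm_scaledSum_le π g t X)
  have h2 := integral_condExp (μ := chainLaw μ π) (f := scaledSum π g t * increment π g t)
    ((trajectoryFiltration n).le t)
  calc _ = ∫ X, (scaledSum π g t * increment π g t) X ∂(chainLaw μ π) := rfl
    _ = ∫ X, (0 : ℝ) ∂(chainLaw μ π) := by
      rw [← h2]
      refine integral_congr_ae ?_
      filter_upwards [h1, condExp_increment μ π g t] with X hX hX'
      rw [hX]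
      simp [hX']
    _ = 0 := integral_zero _ _

theorem integral_scaledSum_sq_le (μ : stdSimplex ℝ (Fin n)) (π : Profile n)
    (g : Fin n → ℝ) (t : ℕ) :
    ∫ X, scaledSum π g t X ^ 2 ∂(chainLaw μ π) ≤ (2 - 1 / ((t : ℝ) + 1)) * (2 * (2 * ‖g‖) ^ 2) := by
  induction t with
  | zero => simp [scaledSum]
  | succ t ih =>
    have hmZ : AEStronglyMeasurable (scaledSum π g t) (chainLaw μ π) :=
      (integrable_scaledSum μ π g t).aestronglyMeasurable
    have hmD : AEStronglyMeasurable (increment π g t) (chainLaw μ π) :=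
      (integrable_increment μ π g t).aestronglyMeasurable
    have hZ2 : Integrable (fun X => scaledSum π g t X ^ 2) (chainLaw μ π) :=
      Integrable.of_bound (hmZ.pow 2) ((t * (2 * ‖g‖)) ^ 2) (Eventually.of_forall fun X => by
        rw [norm_pow]
        exact pow_le_pow_left₀ (norm_nonneg _) (norm_scaledSum_le π g t X) 2)
    have hD2 : Integrable (fun X => increment π g t X ^ 2) (chainLaw μ π) :=
      Integrable.of_bound (hmD.pow 2) ((2 * ‖g‖) ^ 2) (Eventually.of_forall fun X => by
        rw [norm_pow]
        exact pow_le_pow_left₀ (norm_nonneg _) (norm_increment_le π g t X) 2)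
    have hZD : Integrable (fun X => scaledSum π g t X * increment π g t X) (chainLaw μ π) :=
      Integrable.of_bound (hmZ.mul hmD) ((t * (2 * ‖g‖)) * (2 * ‖g‖))
        (Eventually.of_forall fun X => by
          rw [norm_mul]
          exact mul_le_mul (norm_scaledSum_le π g t X) (norm_increment_le π g t X)
            (norm_nonneg _) (by positivity))
    have hD2' : ∫ X, increment π g t X ^ 2 ∂(chainLaw μ π) ≤ (2 * ‖g‖) ^ 2 := by
      calc _ ≤ ∫ X, (2 * ‖g‖) ^ 2 ∂(chainLaw μ π) :=
            integral_mono hD2 (integrable_const _) fun X => by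
              rw [← Real.norm_of_nonneg (sq_nonneg (increment π g t X)), norm_pow]
              exact pow_le_pow_left₀ (norm_nonneg _) (norm_increment_le π g t X) 2
        _ = _ := by simp
    have h1 : ∫ X, scaledSum π g (t + 1) X ^ 2 ∂(chainLaw μ π) =
        ∫ X, scaledSum π g t X ^ 2 ∂(chainLaw μ π)
          + (((t : ℝ) + 1)⁻¹) ^ 2 * ∫ X, increment π g t X ^ 2 ∂(chainLaw μ π) := by
      have h2 : ∀ X, scaledSum π g (t + 1) X ^ 2 = scaledSum π g t X ^ 2
          + (2 * ((t : ℝ) + 1)⁻¹ * (scaledSum π g t X * increment π g t X)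
            + (((t : ℝ) + 1)⁻¹) ^ 2 * increment π g t X ^ 2) := fun X => by
        rw [scaledSum_succ]; ring
      simp_rw [h2]
      have h5 := hZD.const_mul (2 * ((t : ℝ) + 1)⁻¹)
      have h6 := hD2.const_mul ((((t : ℝ) + 1)⁻¹) ^ 2)
      rw [integral_add hZ2 (Integrable.fun_add h5 h6), integral_add h5 h6, integral_const_mul, integral_const_mul,
        integral_scaledSum_mul_increment]
      ring
    -- The factor `2` comes from `t + 2 ≤ 2 (t + 1)`; the right side telescopes into the claimed
    -- bound.
    have h3 : (((t : ℝ) + 1)⁻¹) ^ 2 ≤ 2 * (1 / ((t : ℝ) + 1) - 1 / ((t : ℝ) + 1 + 1)) := by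
      have : (0 : ℝ) ≤ t := Nat.cast_nonneg t
      rw [div_sub_div _ _ (by positivity) (by positivity), inv_pow, inv_eq_one_div, ← mul_div_assoc,
        div_le_div_iff₀ (by positivity) (by positivity)]
      nlinarith
    have h4 : (((t : ℝ) + 1)⁻¹) ^ 2 * ∫ X, increment π g t X ^ 2 ∂(chainLaw μ π) ≤
        2 * (1 / ((t : ℝ) + 1) - 1 / ((t : ℝ) + 1 + 1)) * (2 * ‖g‖) ^ 2 :=
      mul_le_mul h3 hD2' (integral_nonneg fun X => sq_nonneg _) ((by positivity : (0 : ℝ) ≤ _).trans h3)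
    rw [h1]
    push_cast
    linarith

theorem integral_norm_scaledSum_le (μ : stdSimplex ℝ (Fin n)) (π : Profile n)
    (g : Fin n → ℝ) (t : ℕ) :
    ∫ X, ‖scaledSum π g t X‖ ∂(chainLaw μ π) ≤ 1 + 2 * (2 * (2 * ‖g‖) ^ 2) := by
  have hint := integrable_scaledSum μ π g t
  have hZ2 : Integrable (fun X => scaledSum π g t X ^ 2) (chainLaw μ π) :=
    Integrable.of_bound (hint.aestronglyMeasurable.pow 2) ((t * (2 * ‖g‖)) ^ 2)
      (Eventually.of_forall fun X => by
        rw [norm_pow]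
        exact pow_le_pow_left₀ (norm_nonneg _) (norm_scaledSum_le π g t X) 2)
  have hle : ∀ x : ℝ, ‖x‖ ≤ 1 + x ^ 2 := fun x => by
    rw [← sq_abs, ← Real.norm_eq_abs]
    nlinarith [sq_nonneg (‖x‖ - 1)]
  have h0 : ∫ X, ‖scaledSum π g t X‖ ∂(chainLaw μ π) ≤
      ∫ X, (1 + scaledSum π g t X ^ 2) ∂(chainLaw μ π) :=
    integral_mono hint.norm ((integrable_const _).add hZ2) fun X => hle _
  rw [integral_add (integrable_const _) hZ2] at h0
  have h1 := integral_scaledSum_sq_le μ π g t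
  have h2 : 0 ≤ 1 / ((t : ℝ) + 1) * (2 * (2 * ‖g‖) ^ 2) := by positivity
  have h3 : ∫ _, (1 : ℝ) ∂(chainLaw μ π) = 1 := by simp
  linarith

theorem ae_exists_tendsto_scaledSum (μ : stdSimplex ℝ (Fin n)) (π : Profile n)
    (g : Fin n → ℝ) :
    ∀ᵐ X ∂(chainLaw μ π), ∃ l, Tendsto (fun t => scaledSum π g t X) atTop (𝓝 l) :=
  ae_exists_tendsto_of_martingale (martingale_scaledSum μ π g) (integral_norm_scaledSum_le μ π g)

/-- Kronecker's lemma for the weights `1, 2, 3, …`. -/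
theorem tendsto_average_of_tendsto_sum_div {d : ℕ → ℝ} {l : ℝ}
    (hd : Tendsto (fun t => ∑ s ∈ Finset.range t, ((s : ℝ) + 1)⁻¹ * d s) atTop (𝓝 l)) :
    Tendsto (fun t : ℕ => (t : ℝ)⁻¹ * ∑ s ∈ Finset.range t, d s) atTop (𝓝 0) := by
  set Y : ℕ → ℝ := fun t => ∑ s ∈ Finset.range t, ((s : ℝ) + 1)⁻¹ * d s with hY
  -- Summation by parts turns the average of `d` into `Y t` minus the Cesàro mean of `Y`.
  have h1 : ∀ t : ℕ, ∑ s ∈ Finset.range t, d s = t * Y t - ∑ s ∈ Finset.range t, Y s := by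
    intro t
    induction t with
    | zero => simp
    | succ t ih =>
      have h2 : Y (t + 1) = Y t + ((t : ℝ) + 1)⁻¹ * d t := Finset.sum_range_succ _ _
      have h3 : ((t : ℝ) + 1) ≠ 0 := by positivity
      rw [Finset.sum_range_succ, ih, Finset.sum_range_succ, h2]
      push_cast
      field_simp
      ring
  have h4 := hd.sub hd.cesaro
  rw [sub_self] at h4
  refine h4.congr' ?_
  filter_upwards [eventually_gt_atTop 0] with t ht
  have : (t : ℝ) ≠ 0 := by positivity
  rw [h1, mul_sub, inv_mul_cancel_left₀ this]

theorem holdingFrequency_eq (i : Fin n) (X : ℕ → Fin n) (T : ℕ) :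
    holdingFrequency i X T =
      (T : ℝ)⁻¹ * ∑ s ∈ Finset.range T, (Pi.single i 1 : Fin n → ℝ) (X (s + 1)) := by
  rw [holdingFrequency, one_div, Finset.range_eq_Ico, Finset.sum_Ico_add'
    (fun t => (Pi.single i 1 : Fin n → ℝ) (X t))]
  congr 1
  refine Finset.sum_congr (by ext; simp) fun t _ => ?_
  simp [Pi.single_apply]

/-- Along almost every trajectory the holding frequency has the same limit as the harmonic
part of the indicator function. -/
theorem ae_tendsto_holdingFrequency (μ : stdSimplex ℝ (Fin n)) (π : Profile n) (i : Fin n) :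
    ∀ᵐ X ∂(chainLaw μ π), ∃ l,
      Tendsto (fun t => harmonicPart π.toMatrix (Pi.single i 1) (X t)) atTop (𝓝 l) ∧
      Tendsto (holdingFrequency i X) atTop (𝓝 l) := by
  obtain ⟨g, h1, h2⟩ := harmonicPart_spec π.toMatrix_mem_rowStochastic (Pi.single i 1)
  set h := harmonicPart π.toMatrix (Pi.single i 1)
  filter_upwards [ae_exists_tendsto_of_harmonic μ π h1, ae_exists_tendsto_scaledSum μ π g]
    with X ⟨l, hl⟩ ⟨l', hl'⟩
  refine ⟨l, hl, ?_⟩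
  have hM := tendsto_average_of_tendsto_sum_div hl'
  have hces := ((tendsto_add_atTop_iff_nat 1).2 hl).cesaro
  -- At `X (s + 1)`, `g - P g` is the martingale increment plus the telescoping difference `(P g) (X
  -- s) - (P g) (X (s + 1))`, whose sum is bounded.
  have hbd : Tendsto (fun T : ℕ => (T : ℝ)⁻¹ *
      ((π.toMatrix *ᵥ g) (X 0) - (π.toMatrix *ᵥ g) (X T))) atTop (𝓝 0) := by
    refine squeeze_zero_norm (a := fun T : ℕ => (T : ℝ)⁻¹ * (2 * ‖π.toMatrix *ᵥ g‖))
      (fun T => ?_) ?_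
    · rw [norm_mul, Real.norm_of_nonneg (by positivity)]
      gcongr
      refine (norm_sub_le _ _).trans ?_
      linarith [norm_le_pi_norm (π.toMatrix *ᵥ g) (X 0), norm_le_pi_norm (π.toMatrix *ᵥ g) (X T)]
    · simpa using tendsto_inv_atTop_nhds_zero_nat (𝕜 := ℝ) |>.mul_const (2 * ‖π.toMatrix *ᵥ g‖)
  have hsum := (hces.add hM).add hbd
  rw [add_zero, add_zero] at hsum
  refine hsum.congr fun T => ?_
  rw [holdingFrequency_eq, ← mul_add, ← mul_add, ← Finset.sum_range_sub'
    (fun t => (π.toMatrix *ᵥ g) (X t)), ← Finset.sum_add_distrib, ← Finset.sum_add_distrib]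
  congr 1
  refine Finset.sum_congr rfl fun s _ => ?_
  have h3 := congrFun h2 (X (s + 1))
  simp only [Pi.add_apply, Pi.sub_apply] at h3
  rw [h3, increment]
  ring

/-- The expectation of `h (X t)` does not depend on `t`, and dominated convergence identifies its
limit with the payoff. -/
theorem payoff_eq_dotProduct (μ : stdSimplex ℝ (Fin n)) (π : Profile n) (i : Fin n) :
    payoff μ π i = μ.1 ⬝ᵥ harmonicPart π.toMatrix (Pi.single i 1) := by
  obtain ⟨g, h1, -⟩ := harmonicPart_spec π.toMatrix_mem_rowStochastic (Pi.single i 1)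
  set h := harmonicPart π.toMatrix (Pi.single i 1) with hh
  have hconst : ∀ t : ℕ, ∫ X, h (X t) ∂(chainLaw μ π) = μ.1 ⬝ᵥ h := by
    intro t
    induction t with
    | zero => exact integral_comp_eval_zero μ π h
    | succ t ih =>
      rw [← ih, ← integral_condExp ((trajectoryFiltration n).le t)]
      refine integral_congr_ae ?_
      have := condExp_comp_eval_succ μ π h t
      rwa [h1] at this
  have hlim : Tendsto (fun t : ℕ => ∫ X, h (X t) ∂(chainLaw μ π)) atTop (𝓝 (payoff μ π i)) := by
    refine tendsto_integral_of_dominated_convergence (fun _ => ‖h‖)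
      (fun t => (integrable_comp_eval μ π h t).aestronglyMeasurable) (integrable_const _)
      (fun t => Eventually.of_forall fun X => norm_le_pi_norm h (X t)) ?_
    filter_upwards [ae_tendsto_holdingFrequency μ π i] with X ⟨l, hl, hl'⟩
    rwa [hl'.limUnder_eq]
  simp only [hconst] at hlim
  exact tendsto_nhds_unique hlim tendsto_const_nhds |>.symm ▸ rfl

end BuckHolding

/-! ### Comparing payoffs across priors and deviations -/

namespace BuckHolding

open Matrix

variable {n : ℕ}

theorem toMatrix_update_apply_of_ne (π : Profile n) {i k : Fin n} (q : stdSimplex ℝ (Fin n))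
    (hk : k ≠ i) : π.toMatrix k = Profile.toMatrix (Function.update π i q) k := by
  ext l
  simp [Profile.toMatrix, Function.update_of_ne hk]

theorem continuous_toMatrix : Continuous (Profile.toMatrix : Profile n → _) :=
  continuous_matrix fun i j =>
    (continuous_apply j).comp (continuous_subtype_val.comp (continuous_apply i))

theorem payoff_nonneg (μ : stdSimplex ℝ (Fin n)) (π : Profile n) (i : Fin n) :
    0 ≤ payoff μ π i := by
  rw [payoff_eq_dotProduct]
  exact Finset.sum_nonneg fun k _ =>
    mul_nonneg (μ.2.1 k) (harmonicPart_single_mem π.toMatrix_mem_rowStochastic i k).1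

/-- A deviation that is not profitable for a fully supported prior is not profitable for any
prior. -/
theorem payoff_update_le_of_fullySupported {μ : stdSimplex ℝ (Fin n)} (hμ : FullySupported μ)
    (ν : stdSimplex ℝ (Fin n)) (π : Profile n) (i : Fin n) (q : stdSimplex ℝ (Fin n))
    (h : payoff μ (Function.update π i q) i ≤ payoff μ π i) :
    payoff ν (Function.update π i q) i ≤ payoff ν π i := by
  simp only [payoff_eq_dotProduct] at h ⊢
  have hP := π.toMatrix_mem_rowStochastic
  have hP' := Profile.toMatrix_mem_rowStochastic (Function.update π i q)
  have hx := harmonicPart_single_mem hP i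
  have hx' := harmonicPart_single_mem hP' i
  have hc := harmonicPart_cross_mul hP hP' (fun k hk => toMatrix_update_apply_of_ne π q hk)
  set x := harmonicPart π.toMatrix (Pi.single i 1)
  set x' := harmonicPart (Profile.toMatrix (Function.update π i q)) (Pi.single i 1)
  -- Otherwise proportionality gives `x k ≤ x' k` for all `k`, strictly at `i`, and a fully
  -- supported prior would reward the deviation.
  have hi : x' i ≤ x i := by
    by_contra! hlt
    refine h.not_gt (Finset.sum_lt_sum (fun k _ => mul_le_mul_of_nonneg_left ?_ (μ.2.1 k))
      ⟨i, Finset.mem_univ i, mul_lt_mul_of_pos_left hlt (hμ i)⟩)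
    have h0 : 0 < x' i := (hx i).1.trans_lt hlt
    refine le_of_mul_le_mul_right ?_ h0
    rw [hc k]
    exact mul_le_mul_of_nonneg_left hlt.le (hx' k).1
  refine Finset.sum_le_sum fun k _ => mul_le_mul_of_nonneg_left ?_ (ν.2.1 k)
  -- If `x i = 0`, then `x'` is squeezed below `0`; otherwise proportionality can be divided by `x
  -- i`.
  rcases (hx i).1.eq_or_lt with h0 | h0
  · exact ((hx' k).2.trans (hi.trans h0.symm.le)).trans (hx k).1
  · refine le_of_mul_le_mul_right ?_ h0
    rw [← hc k]
    exact mul_le_mul_of_nonneg_left hi (hx k).1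

theorem payoff_eq_of_isIrreducible {π : Profile n} (hπ : π.toMatrix.IsIrreducible)
    (μ ν : stdSimplex ℝ (Fin n)) (i : Fin n) : payoff μ π i = payoff ν π i := by
  rw [payoff_eq_dotProduct, payoff_eq_dotProduct]
  obtain ⟨g, h1, -⟩ := harmonicPart_spec π.toMatrix_mem_rowStochastic (Pi.single i 1)
  have hc := apply_eq_of_harmonic_of_isIrreducible π.toMatrix_mem_rowStochastic hπ h1
  have hval : ∀ ρ : stdSimplex ℝ (Fin n),
      ρ.1 ⬝ᵥ harmonicPart π.toMatrix (Pi.single i 1) = harmonicPart π.toMatrix (Pi.single i 1) i := by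
    intro ρ
    rw [dotProduct, Finset.sum_congr rfl fun k _ => by rw [hc k i], ← Finset.sum_mul, ρ.2.2,
      one_mul]
  rw [hval, hval]

/-- The payoff decreases with the determinant when both systems of equations differ only in
row `i`. -/
theorem dotProduct_le_of_det_le {M M' : Matrix (Fin n) (Fin n) ℝ} {i : Fin n}
    (hM : ∀ k, k ≠ i → M k = M' k) {v x x' : Fin n → ℝ} {c : ℝ} (hx : M *ᵥ x = c • Pi.single i 1)
    (hx' : M' *ᵥ x' = c • Pi.single i 1) (hdet : 0 < M.det) (hle : M.det ≤ M'.det)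
    (h0 : 0 ≤ v ⬝ᵥ x') : v ⬝ᵥ x' ≤ v ⬝ᵥ x := by
  have h1 : M.det * (v ⬝ᵥ x) = M'.det * (v ⬝ᵥ x') := by
    rw [← smul_eq_mul, ← dotProduct_smul, det_smul_eq_det_smul_of_mulVec_eq_single hM hx hx',
      dotProduct_smul, smul_eq_mul]
  refine le_of_mul_le_mul_left ?_ hdet
  rw [h1]
  exact mul_le_mul_of_nonneg_right hle h0

end BuckHolding

/-! ### Existence of equilibria -/

namespace BuckHoldingGame

open BuckHolding Matrix

variable {n : ℕ}

theorem update_mem_profiles {Γ : BuckHoldingGame n} {π : Profile n} (hπ : π ∈ Γ.profiles)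
    {i : Fin n} {q : stdSimplex ℝ (Fin n)} (hq : q ∈ Γ.strategies i) :
    Function.update π i q ∈ Γ.profiles := by
  intro k _
  by_cases hk : k = i
  · subst hk; simpa using hq
  · rw [Function.update_of_ne hk]; exact hπ k trivial

theorem profiles_nonempty (Γ : BuckHoldingGame n) : Γ.profiles.Nonempty :=
  Set.univ_pi_nonempty_iff.2 Γ.strategies_nonempty

theorem IsNash.isPriorFreeNash_of_fullySupported {Γ : BuckHoldingGame n} {π : Profile n}
    (h : Γ.IsNash π) (hΓ : FullySupported Γ.prior) : Γ.IsPriorFreeNash π :=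
  fun ν => ⟨h.1, fun i q hq => not_lt.2 <|
    payoff_update_le_of_fullySupported hΓ ν π i q (not_lt.1 (h.2 i q hq))⟩

theorem IsNash.isPriorFreeNash_of_isIrreducible {Γ : BuckHoldingGame n} {π : Profile n}
    (h : Γ.IsNash π) (hΓ : ∀ π ∈ Γ.profiles, π.toMatrix.IsIrreducible) :
    Γ.IsPriorFreeNash π := fun ν => ⟨h.1, fun i q hq => by
  have h1 := h.2 i q hq
  rwa [payoff_eq_of_isIrreducible (hΓ π h.1) Γ.prior ν,
    payoff_eq_of_isIrreducible (hΓ _ (update_mem_profiles h.1 hq)) Γ.prior ν] at h1⟩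

theorem IsPriorFreeNash.isWeaklyPriorFreeNash {Γ : BuckHoldingGame n} {π : Profile n}
    (h : Γ.IsPriorFreeNash π) : Γ.IsWeaklyPriorFreeNash π := fun ν _ => h ν

/-- A profile that minimizes the determinants `det (1 - s π)` for discount factors `s` arbitrarily
close to `1` is a Nash equilibrium. -/
theorem isNash_of_frequently_det_le {Γ : BuckHoldingGame n} {π : Profile n} (hπ : π ∈ Γ.profiles)
    (hmin : ∃ᶠ s in 𝓝[<] (1 : ℝ), ∀ π' ∈ Γ.profiles,
      (1 - s • π.toMatrix).det ≤ (1 - s • π'.toMatrix).det) : Γ.IsNash π := by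
  refine ⟨hπ, fun i q hq => not_lt.2 ?_⟩
  have hP := π.toMatrix_mem_rowStochastic
  have hP' := Profile.toMatrix_mem_rowStochastic (Function.update π i q)
  rw [payoff_eq_dotProduct, payoff_eq_dotProduct]
  have hcont : Continuous fun x : Fin n → ℝ => Γ.prior.1 ⬝ᵥ x := by fun_prop
  have ht := (hcont.tendsto _).comp (tendsto_resolvent hP (Pi.single i 1))
  have ht' := (hcont.tendsto _).comp (tendsto_resolvent hP' (Pi.single i 1))
  rw [← sub_nonneg]
  -- Both discounted payoffs converge, so the inequality for `s` frequently near `1` passes to the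
  -- limit.
  refine ge_of_tendsto_of_frequently (ht.sub ht') ?_
  refine (hmin.and_eventually (Ioo_mem_nhdsLT (zero_lt_one' ℝ))).mono fun s hs => ?_
  obtain ⟨hs, hs0, hs1⟩ := hs
  refine sub_nonneg.2 (dotProduct_le_of_det_le
    (one_sub_smul_apply_eq (fun k hk => toMatrix_update_apply_of_ne π q hk) s)
    (mulVec_resolvent hP hs0.le hs1 _) (mulVec_resolvent hP' hs0.le hs1 _)
    (det_one_sub_smul_pos hP hs0.le hs1) (hs _ (update_mem_profiles hπ hq)) ?_)
  refine Finset.sum_nonneg fun k _ => mul_nonneg (Γ.prior.2.1 k) ?_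
  refine (le_apply_of_sub_smul_mulVec_eq_single (i := i) hP' hs0.le hs1 ?_ k).1
  rw [← one_sub_smul_mulVec, mulVec_resolvent hP' hs0.le hs1]

/-- Each `s` has a minimizing profile; by the pigeonhole principle one profile serves for `s`
arbitrarily close to `1`. -/
theorem exists_isNash_of_finite {Γ : BuckHoldingGame n} (hΓ : Γ.profiles.Finite) :
    ∃ π, Γ.IsNash π := by
  have h : ∃ᶠ s in 𝓝[<] (1 : ℝ), ∃ π ∈ Γ.profiles, ∀ π' ∈ Γ.profiles,
      (1 - s • π.toMatrix).det ≤ (1 - s • π'.toMatrix).det :=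
    Frequently.of_forall fun s =>
      Set.exists_min_image _ (fun π => (1 - s • π.toMatrix).det) hΓ Γ.profiles_nonempty
  obtain ⟨π, hπ, hmin⟩ := (frequently_exists_finite hΓ).1 h
  exact ⟨π, isNash_of_frequently_det_le hπ hmin⟩

theorem exists_isNash_of_isCompact {Γ : BuckHoldingGame n} (hΓ : IsCompact Γ.profiles)
    (hirr : ∀ π ∈ Γ.profiles, π.toMatrix.IsIrreducible) : ∃ π, Γ.IsNash π := by
  -- At `s = 1` the matrix `1 - P` is singular; the rank-one term makes it invertible and still does
  -- not depend on the profile.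
  let M : Profile n → Matrix (Fin n) (Fin n) ℝ :=
    fun π => 1 - π.toMatrix + vecMulVec 1 Γ.prior.1
  have hM : Continuous M := (continuous_const.sub continuous_toMatrix).add continuous_const
  obtain ⟨π, hπ, hmin⟩ := hΓ.exists_isMinOn Γ.profiles_nonempty
    (f := fun π => (M π).det) hM.matrix_det.continuousOn
  have hpos : ∀ π ∈ Γ.profiles, 0 < (M π).det := fun π hπ =>
    det_one_sub_add_vecMulVec_pos π.toMatrix_mem_rowStochastic (hirr π hπ) Γ.prior.2.2
  have hpay : ∀ π ∈ Γ.profiles, ∀ i, ∃ x : Fin n → ℝ,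
      M π *ᵥ x = (1 : ℝ) • Pi.single i 1 ∧ payoff Γ.prior π i = Γ.prior.1 ⬝ᵥ x := by
    intro π hπ i
    have hx : M π *ᵥ ((M π)⁻¹ *ᵥ Pi.single i 1) = Pi.single i 1 := by
      rw [mulVec_mulVec, mul_nonsing_inv _ (hpos π hπ).ne'.isUnit, one_mulVec]
    refine ⟨_, hx.trans (one_smul _ _).symm, ?_⟩
    rw [payoff_eq_dotProduct, harmonicPart_eq_dotProduct π.toMatrix_mem_rowStochastic hx]
    rw [dotProduct, ← Finset.sum_mul, Γ.prior.2.2, one_mul]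
  refine ⟨π, hπ, fun i q hq => not_lt.2 ?_⟩
  have hπ' := update_mem_profiles hπ hq
  obtain ⟨x, hx, hpx⟩ := hpay π hπ i
  obtain ⟨x', hx', hpx'⟩ := hpay _ hπ' i
  have h0 := payoff_nonneg Γ.prior (Function.update π i q) i
  rw [hpx, hpx']
  refine dotProduct_le_of_det_le (fun k hk => ?_) hx hx' (hpos π hπ) (hmin hπ') (hpx' ▸ h0)
  ext l
  simp [M, congrFun (toMatrix_update_apply_of_ne π q hk) l]

end BuckHoldingGame

/-! ### The PageRank game -/

namespace PageRankData

open BuckHolding Matrix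

variable {n : ℕ}

theorem finite_profiles_game (D : PageRankData n) (μ : stdSimplex ℝ (Fin n)) :
    (D.game μ).profiles.Finite := by
  refine Set.Finite.pi fun i => ?_
  refine Set.Finite.subset (((Set.toFinite (D.links i)).image D.row).preimage
    Subtype.val_injective.injOn) ?_
  rintro p ⟨s, hs, hp⟩
  exact ⟨s, hs, hp.symm⟩

/-- Teleportation makes every entry positive, so the first power already witnesses irreducibility.
-/
theorem isIrreducible_of_mem_profiles_game (D : PageRankData n) (μ : stdSimplex ℝ (Fin n))
    {π : Profile n} (hπ : π ∈ (D.game μ).profiles) : π.toMatrix.IsIrreducible := by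
  have hpos : ∀ i j, 0 < π.toMatrix i j := by
    intro i j
    obtain ⟨s, -, hp⟩ := hπ i trivial
    have h1 : π.toMatrix i j = D.row s j := congrFun hp j
    rw [h1, row]
    have h2 : 0 ≤ 1 - D.α := sub_nonneg.2 D.α_lt_one.le
    have h3 := mul_pos D.α_pos (D.teleport_full j)
    have h4 : (0 : ℝ) ≤ if j ∈ s then 1 else 0 := by split_ifs <;> norm_num
    positivity
  exact (isIrreducible_iff_exists_pow_pos fun i j => (hpos i j).le).2
    fun i j => ⟨1, one_pos, by simpa using hpos i j⟩

end PageRankData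

theorem mainTheorem12 (n : ℕ) :
    (∀ Γ : BuckHoldingGame n,
      (∀ π ∈ Γ.profiles, ∀ i, ∀ᵐ X ∂(BuckHolding.chainLaw Γ.prior π),
        ∃ l : ℝ, Tendsto (BuckHolding.holdingFrequency i X) atTop (𝓝 l)) ∧
      ((Γ.profiles.Finite ∧ BuckHolding.FullySupported Γ.prior) ∨
        (IsCompact Γ.profiles ∧ ∀ π ∈ Γ.profiles, π.toMatrix.IsIrreducible) →
        ∃ π, Γ.IsNash π ∧ Γ.IsWeaklyPriorFreeNash π)) ∧
    (∀ (D : PageRankData n) (μ : stdSimplex ℝ (Fin n)),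
      IsCompact (D.game μ).profiles ∧
      (∀ π ∈ (D.game μ).profiles, π.toMatrix.IsIrreducible) ∧
      (∃ π, (D.game μ).IsNash π ∧ (D.game μ).IsWeaklyPriorFreeNash π) ∧
      (∀ π, (D.game μ).IsNash π → (D.game μ).IsPriorFreeNash π)) := by
  refine ⟨fun Γ => ⟨fun π _ i => ?_, ?_⟩, fun D μ => ?_⟩
  · filter_upwards [BuckHolding.ae_tendsto_holdingFrequency Γ.prior π i] with X ⟨l, _, hl⟩
    exact ⟨l, hl⟩
  · rintro (⟨hfin, hfull⟩ | ⟨hcomp, hirr⟩)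
    · obtain ⟨π, hπ⟩ := BuckHoldingGame.exists_isNash_of_finite hfin
      exact ⟨π, hπ, (hπ.isPriorFreeNash_of_fullySupported hfull).isWeaklyPriorFreeNash⟩
    · obtain ⟨π, hπ⟩ := BuckHoldingGame.exists_isNash_of_isCompact hcomp hirr
      exact ⟨π, hπ, (hπ.isPriorFreeNash_of_isIrreducible hirr).isWeaklyPriorFreeNash⟩
  · have hcomp := (D.finite_profiles_game μ).isCompact
    have hirr : ∀ π ∈ (D.game μ).profiles, π.toMatrix.IsIrreducible :=
      fun π hπ => D.isIrreducible_of_mem_profiles_game μ hπ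
    obtain ⟨π, hπ⟩ := BuckHoldingGame.exists_isNash_of_isCompact hcomp hirr
    exact ⟨hcomp, hirr,
      ⟨π, hπ, (hπ.isPriorFreeNash_of_isIrreducible hirr).isWeaklyPriorFreeNash⟩,
      fun π hπ => hπ.isPriorFreeNash_of_isIrreducible hirr⟩
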